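/- Let $n\ge 0$ be an integer, let the symmetric group $\mathfrak S_n$ act on $\mathbb R^n$ by permuting coordinates and the hyperoctahedral group $B_n$ by permuting coordinates and changing their signs. For $G\in\{\mathfrak S_n,B_n\}$ let $H_{n,k}^{G}$ be the real vector space of $G$-invariant forms (homogeneous polynomials) of degree $k$ in $\mathbb R[X_1,\dots,X_n]$, and let $\mathcal P_{n,k}^{G}\subseteq H_{n,k}^{G}$ be the convex cone of those forms that are non-negative on $\mathbb R^n$. A subset of a finite-dimensional real vector space $W$ is a spectrahedron if it has the form $\{w\in W : A_0+A(w)\succeq 0\}$, where $A_0$ is a real symmetric matrix of some order $N$ and $A$ is a linear map from $W$ to the real symmetric matrices of order $N$; the condition $A_0+A(w)\succeq 0$ is called a linear matrix inequality (LMI) of size $N$. A subset of a finite-dimensional real vector space $V$ is a spectrahedral shadow if it is the image of a spectrahedron in $V\times\mathbb R^m$, for some $m\ge 0$, under the projection to $V$. (1) For every $n$ the cones $\mathcal P_{n,4}^{\mathfrak S_n}$, $\mathcal P_{n,6}^{B_n}$, $\mathcal P_{n,8}^{B_n}$ and $\mathcal P_{n,10}^{B_n}$ are spectrahedral shadows (in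 $H_{n,4}^{\mathfrak S_n}$, $H_{n,6}^{B_n}$, $H_{n,8}^{B_n}$ and $H_{n,10}^{B_n}$, respectively). (2) Non-negativity of forms in these families is certified by an LMI of size $O(n^3)$: there is a constant $c$ such that for every $n$ and each pair $(G,k)\in\{(\mathfrak S_n,4),(B_n,6),(B_n,8),(B_n,10)\}$ there are $N\le c\,n^3$, $m\ge 0$ and an LMI $A_0+A(f,y)\succeq0$ of size $N$ on $H_{n,k}^{G}\times\mathbb R^m$ such that a form $f\in H_{n,k}^{G}$ is non-negative if and only if $A_0+A(f,y)\succeq 0$ for some $y\in\mathbb R^m$. -/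

import Mathlib

open MvPolynomial

noncomputable section

/-! ### Group actions on forms -/

/-- The invertible linear transformations of `ℝⁿ`. -/
abbrev LinAut (n : ℕ) : Type := (Fin n → ℝ) ≃ₗ[ℝ] (Fin n → ℝ)

/-- The action of a linear transformation `g` of `ℝⁿ` on polynomials, `(g f)(X) = f(g⁻¹ X)`:
the variable `X_i` is replaced by the `i`-th coordinate of `g⁻¹ X`, a linear form in `X`. -/
def polyAct {n : ℕ} (g : LinAut n) :
    MvPolynomial (Fin n) ℝ →ₐ[ℝ] MvPolynomial (Fin n) ℝ :=
  bind₁ (fun i => ∑ j, C ((g⁻¹ : LinAut n) (Pi.single j 1) i) * X j)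

/-- The symmetric group `𝔖_n`, acting on `ℝⁿ` by permutation of the coordinates. -/
def symGroup (n : ℕ) : Subgroup (LinAut n) where
  carrier := {g | ∃ σ : Equiv.Perm (Fin n), ∀ x i, g x i = x (σ i)}
  one_mem' := ⟨1, fun _ _ => rfl⟩
  mul_mem' := by
    rintro a b ⟨σ, hσ⟩ ⟨τ, hτ⟩
    exact ⟨τ * σ, fun x i => by
      rw [LinearEquiv.mul_apply, hσ, hτ, Equiv.Perm.mul_apply]⟩
  inv_mem' := by
    rintro a ⟨σ, hσ⟩
    refine ⟨σ⁻¹, fun x i => ?_⟩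
    have h := hσ ((a⁻¹ : LinAut n) x) (σ⁻¹ i)
    rw [← LinearEquiv.mul_apply, mul_inv_cancel, LinearEquiv.coe_one, id,
      show σ (σ⁻¹ i) = i from σ.apply_symm_apply i] at h
    exact h.symm

/-- The hyperoctahedral group `B_n`, acting on `ℝⁿ` by permutation of the coordinates and
sign changes. -/
def hyperoctahedralGroup (n : ℕ) : Subgroup (LinAut n) where
  carrier := {g | ∃ (σ : Equiv.Perm (Fin n)) (ε : Fin n → ℤˣ),
    ∀ x i, g x i = ((ε i : ℤ) : ℝ) * x (σ i)}
  one_mem' := ⟨1, 1, fun _ _ => by simp⟩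
  mul_mem' := by
    rintro a b ⟨σ, ε, hσ⟩ ⟨τ, δ, hτ⟩
    exact ⟨τ * σ, fun i => ε i * δ (σ i), fun x i => by
      rw [LinearEquiv.mul_apply, hσ, hτ, Equiv.Perm.mul_apply]
      push_cast
      ring⟩
  inv_mem' := by
    rintro a ⟨σ, ε, hσ⟩
    refine ⟨σ⁻¹, fun i => ε (σ⁻¹ i), fun x i => ?_⟩
    have h := hσ ((a⁻¹ : LinAut n) x) (σ⁻¹ i)
    rw [← LinearEquiv.mul_apply, mul_inv_cancel, LinearEquiv.coe_one, id,
      show σ (σ⁻¹ i) = i from σ.apply_symm_apply i] at h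
    rw [h, ← mul_assoc, ← Int.cast_mul, ← Units.val_mul, Int.units_mul_self]
    simp

/-- The space `H_{n,k}^G` of `G`-invariant forms of degree `k` in `n` variables. -/
def invariantForms {n : ℕ} (G : Subgroup (LinAut n)) (k : ℕ) :
    Submodule ℝ (MvPolynomial (Fin n) ℝ) where
  carrier := {f | f.IsHomogeneous k ∧ ∀ g ∈ G, polyAct g f = f}
  add_mem' := fun {a b} ha hb =>
    ⟨ha.1.add hb.1, fun g hg => by rw [map_add, ha.2 g hg, hb.2 g hg]⟩
  zero_mem' := ⟨isHomogeneous_zero _ _ _, fun g _ => map_zero _⟩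
  smul_mem' := fun c f hf =>
    ⟨(homogeneousSubmodule (Fin n) ℝ k).smul_mem c hf.1,
      fun g hg => by rw [map_smul, hf.2 g hg]⟩

/-- The convex cone `𝒫_{n,k}^G` of non-negative forms in `H_{n,k}^G`. -/
def nonnegForms {n : ℕ} (G : Subgroup (LinAut n)) (k : ℕ) :
    ConvexCone ℝ (invariantForms G k) where
  carrier := {f | ∀ x : Fin n → ℝ, 0 ≤ eval x (f : MvPolynomial (Fin n) ℝ)}
  smul_mem' := fun c hc f hf x => by
    simpa [smul_eval] using mul_nonneg hc.le (hf x)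
  add_mem' := fun f hf g hg x => by
    simpa using add_nonneg (hf x) (hg x)

/-! ### Spectrahedra and their shadows -/

/-- `S` is the solution set of a linear matrix inequality `A₀ + A(v) ⪰ 0` of size `N`:
`A₀` is a real symmetric `N × N` matrix, and `A(v)` is a real symmetric `N × N` matrix that
depends linearly on `v`. -/
def IsSpectrahedronOfSize {V : Type*} [AddCommGroup V] [Module ℝ V] (N : ℕ) (S : Set V) :
    Prop :=
  ∃ (A₀ : Matrix (Fin N) (Fin N) ℝ) (A : V →ₗ[ℝ] Matrix (Fin N) (Fin N) ℝ),
    A₀.IsSymm ∧ (∀ v, (A v).IsSymm) ∧ S = {v | (A₀ + A v).PosSemidef}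

/-- `S` is a spectrahedron. -/
def IsSpectrahedron {V : Type*} [AddCommGroup V] [Module ℝ V] (S : Set V) : Prop :=
  ∃ N : ℕ, IsSpectrahedronOfSize N S

/-- `S ⊆ V` is a spectrahedral shadow: the projection to `V` of a spectrahedron in some
`V × ℝᵐ`. -/
def IsSpectrahedralShadow {V : Type*} [AddCommGroup V] [Module ℝ V] (S : Set V) : Prop :=
  ∃ (m : ℕ) (T : Set (V × (Fin m → ℝ))), IsSpectrahedron T ∧ S = Prod.fst '' T

/-- Membership in `S ⊆ V` is certified by an LMI of size `N`: there is an LMI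
`A₀ + A(v, y) ⪰ 0` of size `N`, with matrix entries depending affinely on `v ∈ V` and on the
unknowns `y ∈ ℝᵐ`, such that `v ∈ S` if and only if the LMI for `v` has a solution `y`. -/
def IsCertifiedByLMIOfSize {V : Type*} [AddCommGroup V] [Module ℝ V] (N : ℕ) (S : Set V) :
    Prop :=
  ∃ (m : ℕ) (T : Set (V × (Fin m → ℝ))), IsSpectrahedronOfSize N T ∧
    ∀ v, v ∈ S ↔ ∃ y, (v, y) ∈ T

end

/-! The engine is a half-degree principle: a symmetric polynomial `g` of degree at most 5 takes, at
some point with at most two distinct values in the open part `U` of its domain, a value no larger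
than at any given point (`exists_le_eval_two_values`). Fix the first two power sums, which gives a
compact set, minimise `g` there, and among the minimisers maximise the sixth power sum. If three
coordinates in `U` were distinct, they could be moved with `e₁, e₂` fixed and `e₃` shifted by `±ε`.
By weight, `g` is affine in `e₃`, so minimality makes it constant along the move, whereas the sixth
power sum contains `3 e₃ ^ 2` and increases at one of the two points.

For `𝔖_n` in degree 4 this applies directly. A `B_n`-invariant form of degree `2m` is a symmetric
polynomial of degree at most `m ≤ 5` in the squares, on the orthant; coordinates outside `U` are
then zero. Either way, non-negativity need only be tested on vectors with two free values and zeros,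
that is, on `(n + 1) ^ 2` binary forms. Each dehomogenises to a univariate polynomial, which is
non-negative exactly when it has a positive semidefinite Gram matrix of order `m + 1`. Stacking
these blocks gives the LMI, in fact of size `O(n ^ 2)`. -/

noncomputable section

/-! ### Gram matrices of non-negative univariate polynomials -/

/-- The polynomial `∑ M a b X ^ (a + b)` with Gram matrix `M`. -/
def gramPoly (m : ℕ) : Matrix (Fin (m + 1)) (Fin (m + 1)) ℝ →ₗ[ℝ] Polynomial ℝ where
  toFun M := ∑ a : Fin (m + 1), ∑ b : Fin (m + 1), Polynomial.monomial ((a : ℕ) + b) (M a b)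
  map_add' M N := by simp [Finset.sum_add_distrib]
  map_smul' c M := by simp [Finset.smul_sum, Polynomial.smul_monomial]

theorem eval_gramPoly {m : ℕ} (M : Matrix (Fin (m + 1)) (Fin (m + 1)) ℝ) (t : ℝ) :
    (gramPoly m M).eval t
      = star (fun a : Fin (m + 1) => t ^ (a : ℕ)) ⬝ᵥ (M.mulVec fun a => t ^ (a : ℕ)) := by
  simp only [gramPoly, LinearMap.coe_mk, AddHom.coe_mk, Polynomial.eval_finsetSum,
    Polynomial.eval_monomial, dotProduct, Matrix.mulVec, Finset.mul_sum, star_trivial,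
    Pi.star_apply]
  refine Finset.sum_congr rfl fun a _ => Finset.sum_congr rfl fun b _ => ?_
  ring

theorem natDegree_gramPoly_le {m : ℕ} (M : Matrix (Fin (m + 1)) (Fin (m + 1)) ℝ) :
    (gramPoly m M).natDegree ≤ 2 * m := by
  simp only [gramPoly, LinearMap.coe_mk, AddHom.coe_mk]
  refine Polynomial.natDegree_sum_le_of_forall_le _ _ fun a _ =>
    Polynomial.natDegree_sum_le_of_forall_le _ _ fun b _ => ?_
  refine (Polynomial.natDegree_monomial_le _).trans ?_
  omega

theorem gramPoly_vecMulVec {m : ℕ} {p : Polynomial ℝ} (hp : p.natDegree ≤ m) :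
    gramPoly m (Matrix.vecMulVec (fun a => p.coeff a) (star fun a => p.coeff a)) = p ^ 2 := by
  have h : p = ∑ a : Fin (m + 1), Polynomial.monomial (a : ℕ) (p.coeff a) := by
    rw [Fin.sum_univ_eq_sum_range (fun a => Polynomial.monomial a (p.coeff a)) (m + 1)]
    exact p.as_sum_range' _ (Nat.lt_succ_of_le hp)
  conv_rhs => rw [h, sq, Finset.sum_mul_sum]
  simp [gramPoly, Matrix.vecMulVec, Polynomial.monomial_mul_monomial]

/-- The number of pairs of row and column indices on the `s`-th antidiagonal. -/
def antidiagonalCount (m s : ℕ) : ℕ :=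
  (Finset.univ.filter fun x : Fin (m + 1) × Fin (m + 1) => (x.1 : ℕ) + x.2 = s).card

theorem antidiagonalCount_ne_zero {m s : ℕ} (hs : s ≤ 2 * m) : antidiagonalCount m s ≠ 0 := by
  refine Finset.card_ne_zero_of_mem
    (a := (⟨min s m, by omega⟩, ⟨s - min s m, by omega⟩)) ?_
  simp only [Finset.mem_filter, Finset.mem_univ, true_and]
  omega

/-- The Gram matrix of a polynomial that is constant on antidiagonals. -/
def uniformGram (m : ℕ) : Polynomial ℝ →ₗ[ℝ] Matrix (Fin (m + 1)) (Fin (m + 1)) ℝ where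
  toFun p := Matrix.of fun a b => p.coeff (a + b) / antidiagonalCount m (a + b)
  map_add' p q := by ext a b; simp [add_div]
  map_smul' c p := by ext a b; simp [mul_div_assoc]

theorem uniformGram_isSymm (m : ℕ) (p : Polynomial ℝ) : (uniformGram m p).IsSymm := by
  ext a b
  simp [uniformGram, add_comm]

theorem gramPoly_uniformGram {m : ℕ} {p : Polynomial ℝ} (hp : p.natDegree ≤ 2 * m) :
    gramPoly m (uniformGram m p) = p := by
  ext s
  have h : (gramPoly m (uniformGram m p)).coeff s
      = ∑ x : Fin (m + 1) × Fin (m + 1),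
          if (x.1 : ℕ) + x.2 = s then p.coeff s / antidiagonalCount m s else 0 := by
    simp only [gramPoly, uniformGram, LinearMap.coe_mk, AddHom.coe_mk, Polynomial.finsetSum_coeff,
      Polynomial.coeff_monomial, Matrix.of_apply, Fintype.sum_prod_type]
    refine Finset.sum_congr rfl fun a _ => Finset.sum_congr rfl fun b _ => ?_
    split_ifs with hs
    · rw [hs]
    · rfl
  rw [h, ← Finset.sum_filter, Finset.sum_const, nsmul_eq_mul, ← antidiagonalCount]
  -- Division by the count is harmless for `s ≤ 2 * m`; beyond that the coefficient vanishes.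
  rcases le_or_gt s (2 * m) with hs | hs
  · exact mul_div_cancel₀ _ (Nat.cast_ne_zero.2 (antidiagonalCount_ne_zero hs))
  · rw [Polynomial.coeff_eq_zero_of_natDegree_lt (hp.trans_lt hs)]
    simp

theorem nonneg_of_forall_ne {F : ℝ → ℝ} (hF : Continuous F) {t₀ : ℝ}
    (h : ∀ t, t ≠ t₀ → 0 ≤ F t) (t : ℝ) : 0 ≤ F t :=
  closure_minimal (s := {t₀}ᶜ) h (isClosed_Ici.preimage hF) (dense_compl_singleton t₀ t)

/-- A zero of a non-negative function is a minimum, so the derivative vanishes there and the root is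
double. The cofactor is non-negative off `t₀`, hence everywhere by continuity. -/
theorem exists_eq_sq_mul_of_nonneg {q : Polynomial ℝ} (h : ∀ t, 0 ≤ q.eval t) {t₀ : ℝ}
    (h₀ : q.eval t₀ = 0) :
    ∃ r : Polynomial ℝ, q = (Polynomial.X - Polynomial.C t₀) ^ 2 * r ∧ ∀ t, 0 ≤ r.eval t := by
  obtain ⟨p, rfl⟩ := Polynomial.dvd_iff_isRoot.2 h₀
  have hp : p.eval t₀ = 0 := by
    have hmin : IsLocalMin (fun t => ((Polynomial.X - Polynomial.C t₀) * p).eval t) t₀ :=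
      Filter.Eventually.of_forall fun t => h₀.trans_le (h t)
    have := hmin.deriv_eq_zero
    rw [Polynomial.deriv] at this
    simpa [Polynomial.derivative_mul] using this
  obtain ⟨r, rfl⟩ := Polynomial.dvd_iff_isRoot.2 hp
  refine ⟨r, by ring, nonneg_of_forall_ne r.continuous (t₀ := t₀) fun t ht => ?_⟩
  have ht' : 0 < (t - t₀) ^ 2 := by positivity [sub_ne_zero.2 ht]
  refine nonneg_of_mul_nonneg_right (b := r.eval t) ?_ ht'
  have := h t
  simp only [Polynomial.eval_mul, Polynomial.eval_sub, Polynomial.eval_X, Polynomial.eval_C] at this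
  linarith

/-- A sum of squares gives a sum of rank-one Gram matrices. Squares are found by induction on the
degree, without complex roots: subtract the minimum value, a constant square, and split off the
resulting double root. -/
theorem exists_posSemidef_gramPoly_eq (m : ℕ) {q : Polynomial ℝ} (hq : q.natDegree ≤ 2 * m)
    (h : ∀ t, 0 ≤ q.eval t) :
    ∃ M : Matrix (Fin (m + 1)) (Fin (m + 1)) ℝ, M.PosSemidef ∧ gramPoly m M = q := by
  suffices hs : ∃ s : Multiset (Polynomial ℝ), (∀ p ∈ s, p.natDegree ≤ m) ∧
      (s.map (· ^ 2)).sum = q by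
    obtain ⟨s, hs, rfl⟩ := hs
    clear hq h
    induction s using Multiset.induction_on with
    | empty => exact ⟨0, .zero, by simp⟩
    | cons p s ih =>
      obtain ⟨M, hM, hM'⟩ := ih fun p hp => hs p (Multiset.mem_cons_of_mem hp)
      refine ⟨_, (Matrix.posSemidef_vecMulVec_self_star
        (fun a : Fin (m + 1) => p.coeff a)).add hM, ?_⟩
      rw [map_add, gramPoly_vecMulVec (hs p (Multiset.mem_cons_self p s)), hM']
      simp
  induction m generalizing q with
  | zero =>
    rw [Polynomial.eq_C_of_natDegree_le_zero hq] at h ⊢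
    refine ⟨{Polynomial.C √(q.coeff 0)}, by simp, ?_⟩
    rw [Multiset.map_singleton, Multiset.sum_singleton, ← Polynomial.C_pow,
      Real.sq_sqrt (by simpa using h 0)]
  | succ m ih =>
    obtain ⟨t₀, ht₀⟩ := q.exists_forall_norm_le
    set c := q.eval t₀ with hc
    have hle : ∀ t, c ≤ q.eval t := fun t => by
      simpa [abs_of_nonneg (h _), hc] using ht₀ t
    obtain ⟨r, hr, hr'⟩ := exists_eq_sq_mul_of_nonneg (q := q - Polynomial.C c) (t₀ := t₀)
      (fun t => by simpa using hle t) (by simp [hc])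
    have hdeg : r.natDegree ≤ 2 * m := by
      rcases eq_or_ne r 0 with rfl | h0
      · simp
      · have h1 := congrArg Polynomial.natDegree hr
        rw [Polynomial.natDegree_sub_C, Polynomial.natDegree_mul
          (pow_ne_zero _ (Polynomial.X_sub_C_ne_zero _)) h0, Polynomial.natDegree_pow,
          Polynomial.natDegree_X_sub_C] at h1
        omega
    obtain ⟨s, hs, hsr⟩ := ih hdeg hr'
    refine ⟨Polynomial.C √c ::ₘ s.map ((Polynomial.X - Polynomial.C t₀) * ·), ?_, ?_⟩
    · intro p hp
      rcases Multiset.mem_cons.1 hp with rfl | hp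
      · simp
      · obtain ⟨p', hp', rfl⟩ := Multiset.mem_map.1 hp
        refine Polynomial.natDegree_mul_le.trans ?_
        rw [Polynomial.natDegree_X_sub_C]
        have := hs p' hp'
        omega
    · rw [Multiset.map_cons, Multiset.sum_cons, Multiset.map_map, ← Polynomial.C_pow,
        Real.sq_sqrt (h t₀)]
      simp only [Function.comp_def, mul_pow]
      rw [Multiset.sum_map_mul_left, hsr, ← hr]
      ring

/-- The symmetric matrices with Gram polynomial `q`, parametrised by arbitrary matrices `M`. -/
def gramPencil (m : ℕ) :
    Polynomial ℝ × Matrix (Fin (m + 1)) (Fin (m + 1)) ℝ →ₗ[ℝ]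
      Matrix (Fin (m + 1)) (Fin (m + 1)) ℝ where
  -- The `uniformGram` term corrects the Gram polynomial of the symmetrised matrix to `x.1`, so no
  -- linear equations on the unknowns remain to be imposed.
  toFun x := uniformGram m (x.1 - gramPoly m (x.2 + x.2.transpose)) + (x.2 + x.2.transpose)
  map_add' x y := by
    simp only [Prod.fst_add, Prod.snd_add, Matrix.transpose_add, map_sub, map_add]
    abel
  map_smul' c x := by
    simp only [Prod.smul_fst, Prod.smul_snd, Matrix.transpose_smul, map_sub, map_add, map_smul,
      RingHom.id_apply, smul_add, smul_sub]

theorem gramPencil_isSymm (m : ℕ) (x) : (gramPencil m x).IsSymm :=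
  (uniformGram_isSymm m _).add (Matrix.isSymm_add_transpose_self x.2)

theorem nonneg_iff_exists_gramPencil {m : ℕ} {q : Polynomial ℝ} (hq : q.natDegree ≤ 2 * m) :
    (∀ t, 0 ≤ q.eval t) ↔ ∃ M, (gramPencil m (q, M)).PosSemidef := by
  constructor
  · intro h
    obtain ⟨M, hM, rfl⟩ := exists_posSemidef_gramPoly_eq m hq h
    refine ⟨(1 / 2 : ℝ) • M, ?_⟩
    have hT : M.transpose = M := by simpa [Matrix.IsHermitian] using hM.1
    have h2 : (1 / 2 : ℝ) • M + ((1 / 2 : ℝ) • M).transpose = M := by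
      rw [Matrix.transpose_smul, hT, ← add_smul]
      norm_num
    simp only [gramPencil, LinearMap.coe_mk, AddHom.coe_mk, h2]
    simpa using hM
  · rintro ⟨M, hM⟩ t
    have h1 : gramPoly m (gramPencil m (q, M)) = q := by
      simp only [gramPencil, LinearMap.coe_mk, AddHom.coe_mk]
      rw [map_add, gramPoly_uniformGram]
      · ring
      · exact (Polynomial.natDegree_sub_le _ _).trans (max_le hq (natDegree_gramPoly_le _))
    rw [← h1, eval_gramPoly]
    exact hM.dotProduct_mulVec_nonneg _


/-! ### Symmetric polynomials as functions of three coordinates -/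

/-- The `k`-th power sum of three numbers as a polynomial in their product, given their sum `e₁`
and their second elementary symmetric function `e₂`. -/
def triplePowerSum (e₁ e₂ : ℝ) : ℕ → Polynomial ℝ
  | 0 => 3
  | 1 => Polynomial.C e₁
  | 2 => Polynomial.C (e₁ ^ 2 - 2 * e₂)
  | k + 3 => Polynomial.C e₁ * triplePowerSum e₁ e₂ (k + 2)
      - Polynomial.C e₂ * triplePowerSum e₁ e₂ (k + 1) + Polynomial.X * triplePowerSum e₁ e₂ k

/-- Newton's recursion: `a, b, c` are roots of the cubic with coefficients `e₁, e₂, e₃`. -/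
theorem eval_triplePowerSum (a b c : ℝ) (k : ℕ) :
    (triplePowerSum (a + b + c) (a * b + b * c + c * a) k).eval (a * b * c)
      = a ^ k + b ^ k + c ^ k := by
  induction k using Nat.strong_induction_on with
  | _ k ih =>
    match k with
    | 0 => norm_num [triplePowerSum]
    | 1 => simp [triplePowerSum]
    | 2 => simp [triplePowerSum]; ring
    | k + 3 =>
      simp only [triplePowerSum, Polynomial.eval_add, Polynomial.eval_sub, Polynomial.eval_mul,
        Polynomial.eval_C, Polynomial.eval_X, ih (k + 2) (by omega), ih (k + 1) (by omega),
        ih k (by omega)]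
      ring

/-- The product of the three numbers has weight 3. -/
theorem natDegree_triplePowerSum_le (e₁ e₂ : ℝ) (k : ℕ) :
    3 * (triplePowerSum e₁ e₂ k).natDegree ≤ k := by
  induction k using Nat.strong_induction_on with
  | _ k ih =>
    match k with
    | 0 => simp [triplePowerSum]
    | 1 => simp [triplePowerSum]
    | 2 => rw [triplePowerSum, Polynomial.natDegree_C]; norm_num
    | k + 3 =>
      have h2 := ih (k + 2) (by omega)
      have h1 := ih (k + 1) (by omega)
      have h0 := ih k (by omega)
      have := (Polynomial.natDegree_add_le (Polynomial.C e₁ * triplePowerSum e₁ e₂ (k + 2)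
        - Polynomial.C e₂ * triplePowerSum e₁ e₂ (k + 1))
        (Polynomial.X * triplePowerSum e₁ e₂ k))
      have := Polynomial.natDegree_sub_le (Polynomial.C e₁ * triplePowerSum e₁ e₂ (k + 2))
        (Polynomial.C e₂ * triplePowerSum e₁ e₂ (k + 1))
      have := Polynomial.natDegree_C_mul_le e₁ (triplePowerSum e₁ e₂ (k + 2))
      have := Polynomial.natDegree_C_mul_le e₂ (triplePowerSum e₁ e₂ (k + 1))
      have := Polynomial.natDegree_mul_le (p := Polynomial.X) (q := triplePowerSum e₁ e₂ k)
      rw [Polynomial.natDegree_X] at this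
      rw [triplePowerSum]
      omega

/-- The sum of the six monomials obtained from `a ^ i * b ^ j * c ^ k` by permutation. -/
def tripleMonomialSum (i j k : ℕ) (a b c : ℝ) : ℝ :=
  a ^ i * b ^ j * c ^ k + b ^ i * a ^ j * c ^ k + a ^ i * c ^ j * b ^ k
    + c ^ i * a ^ j * b ^ k + b ^ i * c ^ j * a ^ k + c ^ i * b ^ j * a ^ k

/-- The monomial sum is a polynomial in power sums of weight at most 5, so `e₃`, of weight 3, enters
at most linearly. This is where the bound 5 originates. -/
theorem exists_tripleMonomialSum_eq {i j k : ℕ} (h : i + j + k ≤ 5) (e₁ e₂ : ℝ) :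
    ∃ A B : ℝ, ∀ a b c, a + b + c = e₁ → a * b + b * c + c * a = e₂ →
      tripleMonomialSum i j k a b c = A + B * (a * b * c) := by
  set P := triplePowerSum e₁ e₂ with hP
  -- Inclusion-exclusion over coincidences among the three indices.
  set Q := P i * P j * P k - P (i + j) * P k - P (i + k) * P j - P (j + k) * P i
    + 2 * P (i + j + k) with hQ
  have hdeg : Q.natDegree ≤ 1 := by
    have hd : ∀ k, 3 * (P k).natDegree ≤ k := natDegree_triplePowerSum_le e₁ e₂
    have hmul : ∀ {p q : Polynomial ℝ} {r s : ℕ}, 3 * p.natDegree ≤ r → 3 * q.natDegree ≤ s →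
        3 * (p * q).natDegree ≤ r + s := fun {p q r s} hp hq => by
      have := Polynomial.natDegree_mul_le (p := p) (q := q)
      omega
    have h1 := hmul (hmul (hd i) (hd j)) (hd k)
    have h2 := hmul (hd (i + j)) (hd k)
    have h3 := hmul (hd (i + k)) (hd j)
    have h4 := hmul (hd (j + k)) (hd i)
    have h5 := hmul (p := 2) (r := 0) (by simp) (hd (i + j + k))
    have h6 := Polynomial.natDegree_sub_le (P i * P j * P k) (P (i + j) * P k)
    have h7 := Polynomial.natDegree_sub_le (P i * P j * P k - P (i + j) * P k) (P (i + k) * P j)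
    have h8 := Polynomial.natDegree_sub_le
      (P i * P j * P k - P (i + j) * P k - P (i + k) * P j) (P (j + k) * P i)
    have h9 := Polynomial.natDegree_add_le
      (P i * P j * P k - P (i + j) * P k - P (i + k) * P j - P (j + k) * P i) (2 * P (i + j + k))
    rw [hQ]
    omega
  obtain ⟨B, A, hAB⟩ := Polynomial.exists_eq_X_add_C_of_natDegree_le_one hdeg
  refine ⟨A, B, fun a b c h₁ h₂ => ?_⟩
  have he : ∀ k, (P k).eval (a * b * c) = a ^ k + b ^ k + c ^ k := fun k => by
    rw [hP, ← h₁, ← h₂, eval_triplePowerSum]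
  have hE := congrArg (Polynomial.eval (a * b * c)) hAB
  rw [hQ] at hE
  simp only [Polynomial.eval_add, Polynomial.eval_sub, Polynomial.eval_mul, he,
    Polynomial.eval_C, Polynomial.eval_X, Polynomial.eval_ofNat] at hE
  rw [tripleMonomialSum, add_comm A, ← hE]
  ring

theorem sum_pow_six_eq (a b c : ℝ) :
    a ^ 6 + b ^ 6 + c ^ 6 =
      (triplePowerSum (a + b + c) (a * b + b * c + c * a) 6).eval (a * b * c) :=
  (eval_triplePowerSum a b c 6).symm

/-- For fixed `e₁, e₂` the sixth power sum is quadratic in `e₃` with leading coefficient 3. -/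
theorem sum_pow_six_second_difference {a b c a₁ b₁ c₁ a₂ b₂ c₂ ε : ℝ}
    (h₁ : a₁ + b₁ + c₁ = a + b + c) (h₁' : a₁ * b₁ + b₁ * c₁ + c₁ * a₁ = a * b + b * c + c * a)
    (h₁'' : a₁ * b₁ * c₁ = a * b * c + ε)
    (h₂ : a₂ + b₂ + c₂ = a + b + c) (h₂' : a₂ * b₂ + b₂ * c₂ + c₂ * a₂ = a * b + b * c + c * a)
    (h₂'' : a₂ * b₂ * c₂ = a * b * c - ε) :
    (a₁ ^ 6 + b₁ ^ 6 + c₁ ^ 6) + (a₂ ^ 6 + b₂ ^ 6 + c₂ ^ 6)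
      = 2 * (a ^ 6 + b ^ 6 + c ^ 6) + 6 * ε ^ 2 := by
  rw [sum_pow_six_eq, sum_pow_six_eq a₂, sum_pow_six_eq a b c, h₁, h₁', h₁'', h₂, h₂', h₂'']
  simp [triplePowerSum]
  ring

/-- The vector `z` with the coordinates `i, j, k` replaced by `a, b, c`. -/
def updateTriple {n : ℕ} (z : Fin n → ℝ) (i j k : Fin n) (a b c : ℝ) : Fin n → ℝ :=
  Function.update (Function.update (Function.update z k c) j b) i a

section
variable {n : ℕ} {i j k : Fin n}

theorem updateTriple_self (z : Fin n → ℝ) : updateTriple z i j k (z i) (z j) (z k) = z := by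
  simp [updateTriple]

theorem prod_updateTriple (hij : i ≠ j) (hik : i ≠ k) (hjk : j ≠ k) (F : Fin n → ℝ → ℝ)
    (z : Fin n → ℝ) (a b c : ℝ) :
    ∏ r, F r (updateTriple z i j k a b c r)
      = (F i a * F j b * F k c) * ∏ r ∈ Finset.univ \ {i, j, k}, F r (z r) := by
  rw [← Finset.prod_sdiff (Finset.subset_univ {i, j, k}), mul_comm]
  congr 1
  · rw [Finset.prod_insert (by simp [hij, hik]), Finset.prod_pair hjk]
    simp [updateTriple, hij.symm, hik.symm, hjk.symm, mul_assoc]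
  · refine Finset.prod_congr rfl fun r hr => ?_
    simp only [Finset.mem_sdiff, Finset.mem_insert, Finset.mem_singleton, not_or] at hr
    simp [updateTriple, hr.2]

theorem sum_updateTriple (hij : i ≠ j) (hik : i ≠ k) (hjk : j ≠ k) (F : ℝ → ℝ)
    (z : Fin n → ℝ) (a b c : ℝ) :
    ∑ r, F (updateTriple z i j k a b c r)
      = (F a + F b + F c) + ∑ r ∈ Finset.univ \ {i, j, k}, F (z r) := by
  rw [← Finset.sum_sdiff (Finset.subset_univ {i, j, k}), add_comm]
  congr 1
  · rw [Finset.sum_insert (by simp [hij, hik]), Finset.sum_pair hjk]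
    simp [updateTriple, hij.symm, hik.symm, hjk.symm, add_assoc]
  · refine Finset.sum_congr rfl fun r hr => ?_
    simp only [Finset.mem_sdiff, Finset.mem_insert, Finset.mem_singleton, not_or] at hr
    simp [updateTriple, hr.2]

theorem updateTriple_comp_swap_left (hij : i ≠ j) (hik : i ≠ k) (hjk : j ≠ k) (z : Fin n → ℝ)
    (a b c : ℝ) : updateTriple z i j k a b c ∘ Equiv.swap i j = updateTriple z i j k b a c := by
  ext r
  simp only [updateTriple, Function.comp_apply, Function.update_apply, Equiv.swap_apply_def]
  split_ifs <;> simp_all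

theorem updateTriple_comp_swap_right (hij : i ≠ j) (hik : i ≠ k) (hjk : j ≠ k) (z : Fin n → ℝ)
    (a b c : ℝ) : updateTriple z i j k a b c ∘ Equiv.swap j k = updateTriple z i j k a c b := by
  ext r
  simp only [updateTriple, Function.comp_apply, Function.update_apply, Equiv.swap_apply_def]
  split_ifs <;> simp_all

theorem updateTriple_mem {D : Set ℝ} {z : Fin n → ℝ} (hz : ∀ r, z r ∈ D) {a b c : ℝ} (ha : a ∈ D)
    (hb : b ∈ D) (hc : c ∈ D) (r : Fin n) : updateTriple z i j k a b c r ∈ D := by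
  simp only [updateTriple, Function.update_apply]
  split_ifs <;> first | assumption | exact hz r

/-- Averaging over the six permutations of the triple turns each monomial of `g` into a
`tripleMonomialSum` times a constant from the other coordinates. Symmetry is required only on `D`,
since for `B_n` it is derived only on the orthant. -/
theorem exists_eval_updateTriple_eq {g : MvPolynomial (Fin n) ℝ} (hg : g.totalDegree ≤ 5)
    {D : Set ℝ} (hsymm : ∀ (z : Fin n → ℝ) (σ : Equiv.Perm (Fin n)), (∀ r, z r ∈ D) →
      eval (z ∘ σ) g = eval z g)
    (hij : i ≠ j) (hik : i ≠ k) (hjk : j ≠ k) {z : Fin n → ℝ} (hz : ∀ r, z r ∈ D) (e₁ e₂ : ℝ) :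
    ∃ A B : ℝ, ∀ a ∈ D, ∀ b ∈ D, ∀ c ∈ D, a + b + c = e₁ → a * b + b * c + c * a = e₂ →
      eval (updateTriple z i j k a b c) g = A + B * (a * b * c) := by
  have hdeg : ∀ d ∈ g.support, d i + d j + d k ≤ 5 := fun d hd => by
    refine le_trans ?_ ((le_totalDegree hd).trans hg)
    rw [Finsupp.sum_fintype _ _ fun _ => rfl]
    refine le_trans (le_of_eq ?_) (Finset.sum_le_sum_of_subset (Finset.subset_univ {i, j, k}))
    rw [Finset.sum_insert (by simp [hij, hik]), Finset.sum_pair hjk, add_assoc]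
  choose! A B hAB using fun d hd => exists_tripleMonomialSum_eq (hdeg d hd) e₁ e₂
  let R : (Fin n →₀ ℕ) → ℝ := fun d => ∏ r ∈ Finset.univ \ {i, j, k}, z r ^ d r
  refine ⟨(∑ d ∈ g.support, g.coeff d * R d * A d) / 6,
    (∑ d ∈ g.support, g.coeff d * R d * B d) / 6, fun a ha b hb c hc h₁ h₂ => ?_⟩
  have hev : ∀ a b c, eval (updateTriple z i j k a b c) g
      = ∑ d ∈ g.support, g.coeff d * ((a ^ d i * b ^ d j * c ^ d k) * R d) := fun a b c => by
    rw [eval_eq']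
    exact Finset.sum_congr rfl fun d _ => by
      rw [prod_updateTriple hij hik hjk fun r x => x ^ d r]
  have hl : ∀ a ∈ D, ∀ b ∈ D, ∀ c ∈ D, eval (updateTriple z i j k b a c) g
      = eval (updateTriple z i j k a b c) g := fun a ha b hb c hc => by
    rw [← updateTriple_comp_swap_left hij hik hjk, hsymm _ _ (updateTriple_mem hz ha hb hc)]
  have hr : ∀ a ∈ D, ∀ b ∈ D, ∀ c ∈ D, eval (updateTriple z i j k a c b) g
      = eval (updateTriple z i j k a b c) g := fun a ha b hb c hc => by
    rw [← updateTriple_comp_swap_right hij hik hjk, hsymm _ _ (updateTriple_mem hz ha hb hc)]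
  have h6 : 6 * eval (updateTriple z i j k a b c) g
      = ∑ d ∈ g.support, g.coeff d * R d * tripleMonomialSum (d i) (d j) (d k) a b c := by
    have e1 := hl a ha b hb c hc
    have e2 := hr a ha b hb c hc
    have e3 := hl a ha c hc b hb
    have e4 := hr b hb a ha c hc
    have e5 := hl b hb c hc a ha
    have hsum : 6 * eval (updateTriple z i j k a b c) g = eval (updateTriple z i j k a b c) g
        + eval (updateTriple z i j k b a c) g + eval (updateTriple z i j k a c b) g
        + eval (updateTriple z i j k c a b) g + eval (updateTriple z i j k b c a) g
        + eval (updateTriple z i j k c b a) g := by linarith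
    rw [hsum]
    simp only [hev, ← Finset.sum_add_distrib]
    refine Finset.sum_congr rfl fun d _ => ?_
    rw [tripleMonomialSum]
    ring
  rw [Finset.sum_congr rfl fun d hd => by rw [hAB d hd a b c h₁ h₂]] at h6
  simp only [mul_add, Finset.sum_add_distrib, ← mul_assoc, ← Finset.sum_mul] at h6
  linarith

end

/-! ### Perturbation of three distinct numbers -/

/-- Vieta's formulas for `(T - a) * (T - b) * (T - c) - ε`, obtained by divided differences at its
three distinct roots. -/
theorem elementary_eq_of_cubic_roots {a b c x y w ε : ℝ} (hxy : x ≠ y) (hyw : y ≠ w) (hxw : x ≠ w)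
    (hx : (x - a) * (x - b) * (x - c) = ε) (hy : (y - a) * (y - b) * (y - c) = ε)
    (hw : (w - a) * (w - b) * (w - c) = ε) :
    x + y + w = a + b + c ∧ x * y + y * w + w * x = a * b + b * c + c * a ∧
      x * y * w = a * b * c + ε := by
  have h1 : x ^ 2 + x * y + y ^ 2 - (a + b + c) * (x + y) + (a * b + b * c + c * a) = 0 :=
    mul_left_cancel₀ (sub_ne_zero.2 hxy) (by linear_combination hx - hy)
  have h2 : x ^ 2 + x * w + w ^ 2 - (a + b + c) * (x + w) + (a * b + b * c + c * a) = 0 :=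
    mul_left_cancel₀ (sub_ne_zero.2 hxw) (by linear_combination hx - hw)
  have h3 : x + y + w = a + b + c :=
    mul_left_cancel₀ (sub_ne_zero.2 hyw) (by linear_combination h1 - h2)
  have h4 : x * y + y * w + w * x = a * b + b * c + c * a := by
    linear_combination (x + y) * h3 - h1
  refine ⟨h3, h4, ?_⟩
  linear_combination hx + x * h4 - x ^ 2 * h3

theorem exists_perturbation {U : Set ℝ} (hU : IsOpen U) {a b c : ℝ} (ha : a ∈ U) (hb : b ∈ U)
    (hc : c ∈ U) (hab : a < b) (hbc : b < c) :
    ∃ δ > 0, ∀ ε, |ε| < δ → ∃ x ∈ U, ∃ y ∈ U, ∃ w ∈ U, x + y + w = a + b + c ∧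
      x * y + y * w + w * x = a * b + b * c + c * a ∧ x * y * w = a * b * c + ε := by
  obtain ⟨ra, hra, hra'⟩ := Metric.isOpen_iff.1 hU a ha
  obtain ⟨rb, hrb, hrb'⟩ := Metric.isOpen_iff.1 hU b hb
  obtain ⟨rc, hrc, hrc'⟩ := Metric.isOpen_iff.1 hU c hc
  obtain ⟨η, hη, hηa, hηb, hηc, hη₁, hη₂⟩ : ∃ η > 0, η < ra ∧ η < rb ∧ η < rc ∧
      2 * η < b - a ∧ 2 * η < c - b := by
    -- A third of the minimum keeps the three intervals of radius `η` disjoint and inside `U`.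
    refine ⟨min (min ra (min rb rc)) (min (b - a) (c - b)) / 3, ?_, ?_⟩
    · have : 0 < min (min ra (min rb rc)) (min (b - a) (c - b)) := by
        simp [hra, hrb, hrc, hab, hbc]
      positivity
    · have h1 := min_le_left (min ra (min rb rc)) (min (b - a) (c - b))
      have h2 := min_le_right (min ra (min rb rc)) (min (b - a) (c - b))
      have h3 := min_le_left ra (min rb rc)
      have h4 := (min_le_right ra (min rb rc)).trans (min_le_left _ _)
      have h5 := (min_le_right ra (min rb rc)).trans (min_le_right _ _)
      have h6 := min_le_left (b - a) (c - b)
      have h7 := min_le_right (b - a) (c - b)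
      refine ⟨?_, ?_, ?_, ?_, ?_⟩ <;> linarith
  set p : ℝ → ℝ := fun t => (t - a) * (t - b) * (t - c) with hp
  have hcont : Continuous p := by fun_prop
  have hpos : ∀ {u v w : ℝ}, 0 < u → 0 < v → 0 < w → 0 < u * v * w := fun hu hv hw => by positivity
  have s1 : 0 < -p (a - η) := by
    have := @hpos (a - (a - η)) (b - (a - η)) (c - (a - η)) (by linarith)
      (by linarith) (by linarith)
    simp only [hp]; linarith
  have s2 : 0 < p (a + η) := by
    have := @hpos ((a + η) - a) (b - (a + η)) (c - (a + η)) (by linarith)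
      (by linarith) (by linarith)
    simp only [hp]; linarith
  have s3 : 0 < p (b - η) := by
    have := @hpos ((b - η) - a) (b - (b - η)) (c - (b - η)) (by linarith)
      (by linarith) (by linarith)
    simp only [hp]; linarith
  have s4 : 0 < -p (b + η) := by
    have := @hpos ((b + η) - a) ((b + η) - b) (c - (b + η)) (by linarith)
      (by linarith) (by linarith)
    simp only [hp]; linarith
  have s5 : 0 < -p (c - η) := by
    have := @hpos ((c - η) - a) ((c - η) - b) (c - (c - η)) (by linarith)
      (by linarith) (by linarith)
    simp only [hp]; linarith
  have s6 : 0 < p (c + η) := by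
    have := @hpos ((c + η) - a) ((c + η) - b) ((c + η) - c) (by linarith)
      (by linarith) (by linarith)
    simp only [hp]; linarith
  -- The least `|p|` at the six endpoints: for smaller `ε`, `p - ε` still changes sign on each
  -- interval.
  refine ⟨min (min (-p (a - η)) (p (a + η))) (min (min (p (b - η)) (-p (b + η)))
    (min (-p (c - η)) (p (c + η)))), by simp only [lt_min_iff]; tauto, fun ε hε => ?_⟩
  simp only [lt_min_iff] at hε
  obtain ⟨⟨e1, e2⟩, ⟨e3, e4⟩, e5, e6⟩ := hε
  have hε₁ := neg_abs_le ε
  have hε₂ := le_abs_self ε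
  obtain ⟨x, ⟨hx₁, hx₂⟩, hx⟩ := intermediate_value_Icc (by linarith : a - η ≤ a + η)
    hcont.continuousOn (show ε ∈ Set.Icc _ _ from ⟨by linarith, by linarith⟩)
  obtain ⟨y, ⟨hy₁, hy₂⟩, hy⟩ := intermediate_value_Icc' (by linarith : b - η ≤ b + η)
    hcont.continuousOn (show ε ∈ Set.Icc _ _ from ⟨by linarith, by linarith⟩)
  obtain ⟨w, ⟨hw₁, hw₂⟩, hw⟩ := intermediate_value_Icc (by linarith : c - η ≤ c + η)
    hcont.continuousOn (show ε ∈ Set.Icc _ _ from ⟨by linarith, by linarith⟩)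
  refine ⟨x, hra' ?_, y, hrb' ?_, w, hrc' ?_, elementary_eq_of_cubic_roots ?_ ?_ ?_ hx hy hw⟩
  · rw [Metric.mem_ball, Real.dist_eq, abs_lt]; constructor <;> linarith
  · rw [Metric.mem_ball, Real.dist_eq, abs_lt]; constructor <;> linarith
  · rw [Metric.mem_ball, Real.dist_eq, abs_lt]; constructor <;> linarith
  · exact ne_of_lt (by linarith)
  · exact ne_of_lt (by linarith)
  · exact ne_of_lt (by linarith)

/-! ### The half-degree principle in degree at most five -/

theorem exists_le_eval_no_three_values {n : ℕ} {g : MvPolynomial (Fin n) ℝ}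
    (hg : g.totalDegree ≤ 5) {D U : Set ℝ} (hD : IsClosed D) (hU : IsOpen U) (hUD : U ⊆ D)
    (hsymm : ∀ (z : Fin n → ℝ) (σ : Equiv.Perm (Fin n)), (∀ r, z r ∈ D) →
      eval (z ∘ σ) g = eval z g)
    {y : Fin n → ℝ} (hy : ∀ r, y r ∈ D) :
    ∃ z : Fin n → ℝ, (∀ r, z r ∈ D) ∧ eval z g ≤ eval y g ∧
      ∀ i j k, z i ∈ U → z j ∈ U → z k ∈ U → z i < z j → ¬ z j < z k := by
  let K : Set (Fin n → ℝ) := {z | (∀ r, z r ∈ D) ∧ ∑ r, z r = ∑ r, y r ∧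
    ∑ r, z r ^ 2 = ∑ r, y r ^ 2}
  have hKc : IsClosed K := by
    refine IsClosed.inter ?_ (IsClosed.inter ?_ ?_)
    · have h : IsClosed {z : Fin n → ℝ | ∀ r, z r ∈ D} := by
        simpa [Set.pi] using isClosed_set_pi (i := Set.univ) fun (_ : Fin n) _ => hD
      exact h
    · exact isClosed_eq (by fun_prop) continuous_const
    · exact isClosed_eq (by fun_prop) continuous_const
  have hK : IsCompact K := by
    refine Metric.isCompact_of_isClosed_isBounded hKc
      ((Metric.isBounded_closedBall (x := (0 : Fin n → ℝ)) (r := √(∑ r, y r ^ 2))).subset ?_)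
    intro z hz
    rw [mem_closedBall_zero_iff, pi_norm_le_iff_of_nonneg (Real.sqrt_nonneg _)]
    intro r
    refine Real.abs_le_sqrt ?_
    rw [← hz.2.2]
    exact Finset.single_le_sum (f := fun r => z r ^ 2) (fun _ _ => sq_nonneg _) (Finset.mem_univ r)
  have hgc : Continuous fun z : Fin n → ℝ => eval z g := MvPolynomial.continuous_eval g
  obtain ⟨z₀, hz₀, hmin⟩ := hK.exists_isMinOn ⟨y, hy, rfl, rfl⟩ hgc.continuousOn
  have hM : IsCompact (K ∩ {z | eval z g = eval z₀ g}) :=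
    hK.inter_right (isClosed_eq hgc continuous_const)
  -- The tie-break: `g` may be constant along the perturbation, so a strictly convex function of
  -- `e₃` is needed to exclude it.
  obtain ⟨z, ⟨hz, hzm⟩, hmax⟩ := hM.exists_isMaxOn (f := fun z => ∑ r, z r ^ 6) ⟨z₀, hz₀, rfl⟩
    (by fun_prop)
  refine ⟨z, hz.1, hzm.trans_le (hmin (show y ∈ K from ⟨hy, rfl, rfl⟩)),
    fun i j k hi hj hk hzij hzjk => ?_⟩
  have hij : i ≠ j := fun h => by simp [h] at hzij
  have hjk : j ≠ k := fun h => by simp [h] at hzjk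
  have hik : i ≠ k := fun h => (hzij.trans hzjk).ne (by rw [h])
  obtain ⟨δ, hδ, hpert⟩ := exists_perturbation hU hi hj hk hzij hzjk
  obtain ⟨a₁, ha₁, b₁, hb₁, c₁, hc₁, h₁, h₁', h₁''⟩ := hpert (δ / 2) (by
    rw [abs_of_pos (by positivity)]; linarith)
  obtain ⟨a₂, ha₂, b₂, hb₂, c₂, hc₂, h₂, h₂', h₂''⟩ := hpert (-(δ / 2)) (by
    rw [abs_neg, abs_of_pos (by positivity)]; linarith)
  obtain ⟨A, B, hAB⟩ := exists_eval_updateTriple_eq hg hsymm hij hik hjk hz.1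
    (z i + z j + z k) (z i * z j + z j * z k + z k * z i)
  have hg₀ := hAB _ (hz.1 i) _ (hz.1 j) _ (hz.1 k) rfl rfl
  have hg₁ := hAB a₁ (hUD ha₁) b₁ (hUD hb₁) c₁ (hUD hc₁) h₁ h₁'
  have hg₂ := hAB a₂ (hUD ha₂) b₂ (hUD hb₂) c₂ (hUD hc₂) h₂ h₂'
  rw [updateTriple_self] at hg₀
  have hmem : ∀ {a b c : ℝ}, a ∈ U → b ∈ U → c ∈ U → a + b + c = z i + z j + z k →
      a * b + b * c + c * a = z i * z j + z j * z k + z k * z i →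
      updateTriple z i j k a b c ∈ K := fun {a b c} ha hb hc h h' => by
    refine ⟨updateTriple_mem hz.1 (hUD ha) (hUD hb) (hUD hc), ?_, ?_⟩
    · rw [← hz.2.1, sum_updateTriple hij hik hjk fun x => x]
      conv_rhs => rw [← updateTriple_self (i := i) (j := j) (k := k) z,
        sum_updateTriple hij hik hjk fun x => x]
      rw [h]
    · rw [← hz.2.2, sum_updateTriple hij hik hjk fun x => x ^ 2]
      conv_rhs => rw [← updateTriple_self (i := i) (j := j) (k := k) z,
        sum_updateTriple hij hik hjk fun x => x ^ 2]
      congr 1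
      linear_combination (a + b + c + z i + z j + z k) * h - 2 * h'
  have hm₁ := hmem ha₁ hb₁ hc₁ h₁ h₁'
  have hm₂ := hmem ha₂ hb₂ hc₂ h₂ h₂'
  have hle₁ : eval z₀ g ≤ _ := hmin hm₁
  have hle₂ : eval z₀ g ≤ _ := hmin hm₂
  have hzm' : eval z g = eval z₀ g := hzm
  rw [h₁''] at hg₁
  rw [h₂''] at hg₂
  -- The values of `g` at the two perturbed points average to its minimum and are not below it, so
  -- both points are minimisers.
  have hmax₁ := hmax (show updateTriple z i j k a₁ b₁ c₁ ∈ _ from ⟨hm₁, show _ = _ by linarith⟩)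
  have hmax₂ := hmax (show updateTriple z i j k a₂ b₂ c₂ ∈ _ from ⟨hm₂, show _ = _ by linarith⟩)
  have h6 := sum_updateTriple hij hik hjk (fun x => x ^ 6) z (z i) (z j) (z k)
  rw [updateTriple_self] at h6
  simp only [Set.mem_ofPred_eq, sum_updateTriple hij hik hjk fun x => x ^ 6] at hmax₁ hmax₂
  have hdiff := sum_pow_six_second_difference h₁ h₁' h₁'' h₂ h₂' (by linarith)
  have : 0 < δ ^ 2 := by positivity
  linarith

/-- Take the least and greatest coordinates in `U`; anything strictly between would be a third
value. -/
theorem exists_le_eval_two_values {n : ℕ} {g : MvPolynomial (Fin n) ℝ}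
    (hg : g.totalDegree ≤ 5) {D U : Set ℝ} (hD : IsClosed D) (hU : IsOpen U) (hUD : U ⊆ D)
    (hsymm : ∀ (z : Fin n → ℝ) (σ : Equiv.Perm (Fin n)), (∀ r, z r ∈ D) →
      eval (z ∘ σ) g = eval z g)
    {y : Fin n → ℝ} (hy : ∀ r, y r ∈ D) :
    ∃ z : Fin n → ℝ, (∀ r, z r ∈ D) ∧ eval z g ≤ eval y g ∧
      ∃ a b, ∀ r, z r = a ∨ z r = b ∨ z r ∉ U := by
  obtain ⟨z, hz, hle, h⟩ := exists_le_eval_no_three_values hg hD hU hUD hsymm hy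
  refine ⟨z, hz, hle, ?_⟩
  classical
  rcases (Finset.univ.filter fun r => z r ∈ U).eq_empty_or_nonempty with hF | hF
  · exact ⟨0, 0, fun r => Or.inr (Or.inr fun hr => Finset.filter_eq_empty_iff.1 hF
      (Finset.mem_univ r) hr)⟩
  · obtain ⟨i, hi, hmin⟩ := Finset.exists_min_image _ z hF
    obtain ⟨k, hk, hmax⟩ := Finset.exists_max_image _ z hF
    simp only [Finset.mem_filter, Finset.mem_univ, true_and] at hi hk hmin hmax
    refine ⟨z i, z k, fun r => ?_⟩
    by_contra! hr
    exact h i r k hi hr.2.2 hk (lt_of_le_of_ne (hmin r hr.2.2) (Ne.symm hr.1))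
      (lt_of_le_of_ne (hmax r hr.2.2) hr.2.1)


/-! ### Test vectors with two distinct non-zero coordinates -/

/-- The vector whose first `j` coordinates are `a`, whose coordinates from `j` to `l` are `b`, and
whose remaining coordinates vanish. -/
def blockVector {R : Type*} [Zero R] (n j l : ℕ) (a b : R) : Fin n → R :=
  fun r => if (r : ℕ) < j then a else if (r : ℕ) < l then b else 0

theorem exists_comp_perm_eq_blockVector {n : ℕ} {z : Fin n → ℝ} {a b : ℝ}
    (h : ∀ r, z r = a ∨ z r = b ∨ z r = 0) :
    ∃ σ : Equiv.Perm (Fin n), ∃ j ≤ n, ∃ l ≤ n, z ∘ σ = blockVector n j l a b := by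
  -- Sorting by this colour groups equal coordinates; `j` and `l` count the colours at most 0 and at
  -- most 1.
  let c : Fin n → ℕ := fun r => if z r = a then 0 else if z r = b then 1 else 2
  have hcut : ∀ q, ∃ j ≤ n, ∀ r : Fin n, (r : ℕ) < j ↔ c (Tuple.sort c r) ≤ q := fun q =>
    ⟨Finset.card {r | (c ∘ Tuple.sort c) r ≤ q},
      (Finset.card_le_univ _).trans_eq (Fintype.card_fin n),
      fun _ => Tuple.lt_card_le_iff_apply_le_of_monotone (Tuple.monotone_sort c)⟩
  obtain ⟨j, hj, hj'⟩ := hcut 0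
  obtain ⟨l, hl, hl'⟩ := hcut 1
  refine ⟨Tuple.sort c, j, hj, l, hl, ?_⟩
  ext r
  simp only [blockVector, hj', hl', Function.comp_apply]
  have := h (Tuple.sort c r)
  generalize Tuple.sort c r = u at this ⊢
  simp only [c]
  grind

theorem continuous_blockVector (n j l : ℕ) (a : ℝ) : Continuous fun b => blockVector n j l a b := by
  refine continuous_pi fun r => ?_
  simp only [blockVector]
  split_ifs <;> fun_prop

/-- The dehomogenised restriction of a form to the vectors `blockVector n j l t 1`. -/
def blockRestriction (n j l : ℕ) : MvPolynomial (Fin n) ℝ →ₐ[ℝ] Polynomial ℝ :=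
  aeval (blockVector n j l Polynomial.X 1)

theorem eval_blockRestriction {n : ℕ} (j l : ℕ) (f : MvPolynomial (Fin n) ℝ) (t : ℝ) :
    (blockRestriction n j l f).eval t = eval (blockVector n j l t 1) f := by
  have hX : ∀ r, (blockVector n j l Polynomial.X 1 r).eval t = blockVector n j l t 1 r :=
    fun r => by simp only [blockVector]; split_ifs <;> simp
  rw [blockRestriction]
  induction f using MvPolynomial.induction_on with
  | C a => simp
  | add p q hp hq => simp [hp, hq]
  | mul_X p r hp => simp [hp, hX]

theorem natDegree_blockRestriction_le {n k : ℕ} (j l : ℕ) {f : MvPolynomial (Fin n) ℝ}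
    (hf : f.IsHomogeneous k) : (blockRestriction n j l f).natDegree ≤ k := by
  have := aeval_natDegree_le (n := 1) f hf.totalDegree_le (blockVector n j l Polynomial.X 1)
    fun r => by simp only [blockVector]; split_ifs <;> simp
  simpa [blockRestriction] using this

theorem eval_smul_vector {n k : ℕ} {f : MvPolynomial (Fin n) ℝ} (hf : f.IsHomogeneous k)
    (c : ℝ) (x : Fin n → ℝ) : eval (c • x) f = c ^ k * eval x f := by
  rw [eval_eq', eval_eq', Finset.mul_sum]
  refine Finset.sum_congr rfl fun d hd => ?_
  have hk : k = ∑ i, d i := by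
    rw [hf.degree_eq_sum_deg_support hd]
    exact Finset.sum_subset (Finset.subset_univ _) fun i _ hi => Finsupp.notMem_support_iff.1 hi
  rw [hk, ← Finset.prod_pow_eq_pow_sum, mul_left_comm, ← Finset.prod_mul_distrib]
  simp [mul_pow]

/-- For `b ≠ 0`, scale by `b`: the degree is even, so the factor is non-negative. The case `b = 0`
follows by continuity. -/
theorem eval_blockVector_nonneg {n m j l : ℕ} {f : MvPolynomial (Fin n) ℝ}
    (hf : f.IsHomogeneous (2 * m)) (h : ∀ t, 0 ≤ (blockRestriction n j l f).eval t) (a b : ℝ) :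
    0 ≤ eval (blockVector n j l a b) f := by
  refine nonneg_of_forall_ne (F := fun b => eval (blockVector n j l a b) f) (t₀ := 0)
    ((MvPolynomial.continuous_eval f).comp (continuous_blockVector n j l a)) (fun b hb => ?_) b
  have hsmul : blockVector n j l a b = b • blockVector n j l (a / b) 1 := by
    ext r
    simp only [blockVector, Pi.smul_apply, smul_eq_mul]
    split_ifs <;> simp [mul_div_cancel₀ _ hb]
  rw [hsmul, eval_smul_vector hf, pow_mul, ← eval_blockRestriction]
  exact mul_nonneg (by positivity) (h _)

/-! ### Invariance under the groups -/

theorem eval_polyAct {n : ℕ} (g : LinAut n) (f : MvPolynomial (Fin n) ℝ) (x : Fin n → ℝ) :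
    eval x (polyAct g f) = eval ((g⁻¹ : LinAut n) x) f := by
  have hx : (fun i => eval x (∑ j, C ((g⁻¹ : LinAut n) (Pi.single j 1) i) * X j))
      = (g⁻¹ : LinAut n) x := by
    ext i
    conv_rhs => rw [pi_eq_sum_univ' x]
    simp [mul_comm]
  rw [polyAct, ← hx]
  induction f using MvPolynomial.induction_on with
  | C a => simp
  | add p q hp hq => simp only [map_add, hp, hq]
  | mul_X p r hp => simp only [map_mul, hp, bind₁_X_right, eval_X]

theorem eval_apply_eq_of_mem {n k : ℕ} {G : Subgroup (LinAut n)} {f : MvPolynomial (Fin n) ℝ}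
    (hf : f ∈ invariantForms G k) {g : LinAut n} (hg : g ∈ G) (x : Fin n → ℝ) :
    eval (g x) f = eval x f := by
  have := eval_polyAct g⁻¹ f x
  rwa [hf.2 _ (G.inv_mem hg), inv_inv, eq_comm] at this

/-- The permutation of coordinates combined with sign changes. -/
def signedPerm {n : ℕ} (σ : Equiv.Perm (Fin n)) (ε : Fin n → ℤˣ) : LinAut n :=
  (LinearEquiv.funCongrLeft ℝ ℝ σ).trans
    (LinearEquiv.piCongrRight fun i => LinearEquiv.smulOfUnit (Units.map (Int.castRingHom ℝ) (ε i)))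

theorem signedPerm_apply {n : ℕ} (σ : Equiv.Perm (Fin n)) (ε : Fin n → ℤˣ) (x : Fin n → ℝ) :
    signedPerm σ ε x = fun i => ((ε i : ℤ) : ℝ) * x (σ i) := by
  ext i
  rfl

theorem eval_comp_perm_symGroup {n k : ℕ} {f : MvPolynomial (Fin n) ℝ}
    (hf : f ∈ invariantForms (symGroup n) k) (σ : Equiv.Perm (Fin n)) (x : Fin n → ℝ) :
    eval (x ∘ σ) f = eval x f := by
  rw [← eval_apply_eq_of_mem hf (g := signedPerm σ 1) ⟨σ, fun x i => by simp [signedPerm_apply]⟩ x,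
    signedPerm_apply]
  simp [Function.comp_def]

theorem eval_signedPerm_hyperoctahedralGroup {n k : ℕ} {f : MvPolynomial (Fin n) ℝ}
    (hf : f ∈ invariantForms (hyperoctahedralGroup n) k) (σ : Equiv.Perm (Fin n)) (ε : Fin n → ℤˣ)
    (x : Fin n → ℝ) : eval (fun i => ((ε i : ℤ) : ℝ) * x (σ i)) f = eval x f := by
  rw [← eval_apply_eq_of_mem hf (g := signedPerm σ ε)
    ⟨σ, ε, fun x i => by simp [signedPerm_apply]⟩ x, signedPerm_apply]

theorem eval_comp_perm_hyperoctahedralGroup {n k : ℕ} {f : MvPolynomial (Fin n) ℝ}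
    (hf : f ∈ invariantForms (hyperoctahedralGroup n) k) (σ : Equiv.Perm (Fin n)) (x : Fin n → ℝ) :
    eval (x ∘ σ) f = eval x f := by
  simpa [Function.comp_def] using eval_signedPerm_hyperoctahedralGroup hf σ 1 x

/-- Averaging over all sign changes kills every monomial with an odd exponent; the remaining
exponents are halved. -/
theorem exists_eval_eq_eval_sq {n m : ℕ} {f : MvPolynomial (Fin n) ℝ}
    (hf : f ∈ invariantForms (hyperoctahedralGroup n) (2 * m)) :
    ∃ g : MvPolynomial (Fin n) ℝ, g.totalDegree ≤ m ∧
      ∀ x, eval x f = eval (fun i => x i ^ 2) g := by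
  classical
  let s := f.support.filter fun d => ∀ i, Even (d i)
  let half : (Fin n →₀ ℕ) → (Fin n →₀ ℕ) := Finsupp.mapRange (· / 2) rfl
  refine ⟨∑ d ∈ s, monomial (half d) (f.coeff d), ?_, fun x => ?_⟩
  · refine totalDegree_finsetSum_le fun d hd => (totalDegree_monomial_le _ _).trans ?_
    have hd' : d ∈ f.support := (Finset.mem_filter.1 hd).1
    have h2 := (le_totalDegree hd').trans hf.1.totalDegree_le
    have h3 : ∀ i, d i = half d i * 2 := fun i =>
      (Nat.div_mul_cancel ((Finset.mem_filter.1 hd).2 i).two_dvd).symm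
    rw [Finsupp.sum_fintype _ _ fun _ => rfl] at h2 ⊢
    simp only [id_eq] at h2 ⊢
    rw [Finset.sum_congr rfl fun i _ => h3 i, ← Finset.sum_mul] at h2
    omega
  · have havg : (2 : ℝ) ^ n * eval x f
        = ∑ ε : Fin n → ℤˣ, eval (fun i => ((ε i : ℤ) : ℝ) * x i) f := by
      have hε : ∀ ε : Fin n → ℤˣ, eval (fun i => ((ε i : ℤ) : ℝ) * x i) f = eval x f := fun ε =>
        eval_signedPerm_hyperoctahedralGroup hf 1 ε x
      rw [Finset.sum_congr rfl fun ε _ => hε ε]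
      simp
    have hmon : ∀ d : Fin n →₀ ℕ, ∑ ε : Fin n → ℤˣ, ∏ i, (((ε i : ℤ) : ℝ) * x i) ^ d i
        = if ∀ i, Even (d i) then 2 ^ n * ∏ i, (x i ^ 2) ^ half d i else 0 := fun d => by
      -- The sum over sign vectors factors coordinatewise, and a factor with odd exponent is zero.
      have := Finset.prod_univ_sum (fun _ : Fin n => (Finset.univ : Finset ℤˣ))
        (fun i u => (((u : ℤ) : ℝ) * x i) ^ d i)
      rw [Fintype.piFinset_univ] at this
      rw [← this]
      have hi : ∀ i, ∑ u : ℤˣ, (((u : ℤ) : ℝ) * x i) ^ d i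
          = if Even (d i) then 2 * (x i ^ 2) ^ half d i else 0 := fun i => by
        rw [show (Finset.univ : Finset ℤˣ) = {1, -1} from rfl, Finset.sum_pair (by decide)]
        split_ifs with he
        · have : 2 * half d i = d i := Nat.mul_div_cancel' he.two_dvd
          rw [← pow_mul, this]
          simp [he.neg_pow, two_mul]
        · simp [(Nat.not_even_iff_odd.1 he).neg_pow]
      rw [Finset.prod_congr rfl fun i _ => hi i]
      split_ifs with he
      · rw [Finset.prod_congr rfl fun i _ => if_pos (he i), Finset.prod_mul_distrib]
        simp
      · obtain ⟨i, hi⟩ := not_forall.1 he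
        exact Finset.prod_eq_zero (Finset.mem_univ i) (if_neg hi)
    refine mul_left_cancel₀ (pow_ne_zero n two_ne_zero : (2 : ℝ) ^ n ≠ 0) ?_
    rw [havg]
    simp only [eval_eq' _ f]
    rw [Finset.sum_comm]
    simp only [← Finset.mul_sum, hmon]
    simp only [s, Finset.sum_filter, map_sum, apply_ite (eval _), eval_monomial, Finset.mul_sum,
      map_zero]
    refine Finset.sum_congr rfl fun d _ => ?_
    split_ifs
    · rw [Finsupp.prod_fintype _ _ fun _ => pow_zero _]
      ring
    · simp

theorem nonneg_of_blockVector_symGroup {n k : ℕ} (hk : k ≤ 5) {f : MvPolynomial (Fin n) ℝ}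
    (hf : f ∈ invariantForms (symGroup n) k)
    (h : ∀ j ≤ n, ∀ l ≤ n, ∀ a b, 0 ≤ eval (blockVector n j l a b) f) (x : Fin n → ℝ) :
    0 ≤ eval x f := by
  obtain ⟨z, -, hle, a, b, hab⟩ := exists_le_eval_two_values (hf.1.totalDegree_le.trans hk)
    isClosed_univ isOpen_univ le_rfl (fun z σ _ => eval_comp_perm_symGroup hf σ z)
    (y := x) fun _ => Set.mem_univ _
  obtain ⟨σ, j, hj, l, hl, hσ⟩ := exists_comp_perm_eq_blockVector (z := z) (a := a) (b := b)
    fun r => by simpa using (hab r).imp_right fun h => h.imp_right (absurd (Set.mem_univ _))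
  have := h j hj l hl a b
  rw [← hσ, eval_comp_perm_symGroup hf] at this
  exact this.trans hle

/-- Apply the two-value principle to the squares, with `D = [0, ∞)` and `U = (0, ∞)`, and return by
square roots; boundary coordinates supply the zeros of the test vector. -/
theorem nonneg_of_blockVector_hyperoctahedralGroup {n m : ℕ} (hm : m ≤ 5)
    {f : MvPolynomial (Fin n) ℝ} (hf : f ∈ invariantForms (hyperoctahedralGroup n) (2 * m))
    (h : ∀ j ≤ n, ∀ l ≤ n, ∀ a b, 0 ≤ eval (blockVector n j l a b) f) (x : Fin n → ℝ) :
    0 ≤ eval x f := by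
  obtain ⟨g, hg, hfg⟩ := exists_eval_eq_eval_sq hf
  have hsqrt : ∀ z : Fin n → ℝ, (∀ r, z r ∈ Set.Ici (0 : ℝ)) →
      eval z g = eval (fun i => √(z i)) f := fun z hz => by
    rw [hfg]
    congr 2
    ext i
    exact (Real.sq_sqrt (hz i)).symm
  obtain ⟨z, hz, hle, a, b, hab⟩ := exists_le_eval_two_values (hg.trans hm)
    (isClosed_Ici (a := (0 : ℝ))) isOpen_Ioi Set.Ioi_subset_Ici_self
    (fun z σ hz => by
      rw [hsqrt z hz, hsqrt (z ∘ σ) fun r => hz (σ r),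
        ← eval_comp_perm_hyperoctahedralGroup hf σ fun i => √(z i)]
      rfl) (y := fun i => x i ^ 2) fun i => sq_nonneg (x i)
  rw [← hfg, hsqrt z hz] at hle
  obtain ⟨σ, j, hj, l, hl, hσ⟩ := exists_comp_perm_eq_blockVector (z := fun i => √(z i))
    (a := √a) (b := √b) fun r => by
      rcases hab r with h | h | h
      · simp [h]
      · simp [h]
      · exact Or.inr (Or.inr (Real.sqrt_eq_zero_of_nonpos (not_lt.1 h)))
  have := h j hj l hl √a √b
  rw [← hσ, eval_comp_perm_hyperoctahedralGroup hf] at this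
  exact this.trans hle

/-! ### The linear matrix inequality -/

theorem posSemidef_blockDiagonal_iff {ι κ : Type*} [Fintype ι] [DecidableEq ι] [Fintype κ]
    {M : κ → Matrix ι ι ℝ} [DecidableEq κ] :
    (Matrix.blockDiagonal M).PosSemidef ↔ ∀ k, (M k).PosSemidef := by
  constructor
  · intro h k
    have := h.submatrix fun i => (i, k)
    convert this using 1
    ext i j
    simp [Matrix.blockDiagonal_apply]
  · intro h
    refine .of_dotProduct_mulVec_nonneg ?_ fun x => ?_
    · rw [Matrix.IsHermitian, Matrix.blockDiagonal_conjTranspose]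
      exact congrArg _ (funext fun k => (h k).1)
    · have := Finset.sum_nonneg fun k (_ : k ∈ Finset.univ) =>
        (h k).dotProduct_mulVec_nonneg fun i => x (i, k)
      refine this.trans_eq ?_
      simp only [dotProduct, Matrix.mulVec, Fintype.sum_prod_type, Matrix.blockDiagonal_apply]
      rw [Finset.sum_comm]
      simp

theorem isCertifiedByLMIOfSize_of_blocks {V : Type*} [AddCommGroup V] [Module ℝ V] {S : Set V}
    {κ : Type*} [Fintype κ] (m : ℕ) (q : κ → V →ₗ[ℝ] Polynomial ℝ)
    (hq : ∀ k v, (q k v).natDegree ≤ 2 * m) (hS : ∀ v, v ∈ S ↔ ∀ k t, 0 ≤ (q k v).eval t) :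
    IsCertifiedByLMIOfSize (Fintype.card κ * (m + 1)) S := by
  classical
  let Y := κ → Matrix (Fin (m + 1)) (Fin (m + 1)) ℝ
  let e : (Fin (Module.finrank ℝ Y) → ℝ) ≃ₗ[ℝ] Y := (Module.finBasis ℝ Y).equivFun.symm
  let i : Fin (m + 1) × κ ≃ Fin (Fintype.card κ * (m + 1)) :=
    Fintype.equivFinOfCardEq (by simp [mul_comm])
  let B : V × (Fin (Module.finrank ℝ Y) → ℝ) →ₗ[ℝ] Y :=
    LinearMap.pi fun k => gramPencil m ∘ₗ
      ((q k ∘ₗ LinearMap.fst ℝ _ _).prod (LinearMap.proj k ∘ₗ e.toLinearMap ∘ₗ LinearMap.snd ℝ _ _))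
  have hB : ∀ v y k, B (v, y) k = gramPencil m (q k v, e y k) := fun _ _ _ => rfl
  let A : V × (Fin (Module.finrank ℝ Y) → ℝ) →ₗ[ℝ]
      Matrix (Fin (Fintype.card κ * (m + 1))) (Fin (Fintype.card κ * (m + 1))) ℝ :=
    { toFun := fun x => (Matrix.blockDiagonal (B x)).submatrix i.symm i.symm
      map_add' := fun x y => by rw [map_add, Matrix.blockDiagonal_add]; rfl
      map_smul' := fun c x => by rw [map_smul, Matrix.blockDiagonal_smul]; rfl }
  have hA : ∀ x, (A x).PosSemidef ↔ ∀ k, (B x k).PosSemidef := fun x =>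
    (Matrix.posSemidef_submatrix_equiv i.symm).trans posSemidef_blockDiagonal_iff
  refine ⟨_, _, ⟨0, A, Matrix.isSymm_zero, fun x => ?_, rfl⟩, fun v => ?_⟩
  · refine Matrix.IsSymm.submatrix ?_ _
    rw [Matrix.IsSymm, Matrix.blockDiagonal_transpose]
    exact congrArg _ (funext fun k => gramPencil_isSymm m _)
  · simp only [Set.mem_ofPred_eq, zero_add, hA, hB, hS]
    constructor
    · intro h
      choose M hM using fun k => (nonneg_iff_exists_gramPencil (hq k v)).1 (h k)
      exact ⟨e.symm M, fun k => by simpa using hM k⟩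
    · rintro ⟨y, hy⟩ k
      exact (nonneg_iff_exists_gramPencil (hq k v)).2 ⟨_, hy k⟩

theorem isCertifiedByLMIOfSize_nonnegForms {n m : ℕ} {G : Subgroup (LinAut n)}
    (h : ∀ f ∈ invariantForms G (2 * m),
      (∀ j ≤ n, ∀ l ≤ n, ∀ a b, 0 ≤ eval (blockVector n j l a b) f) → ∀ x, 0 ≤ eval x f) :
    IsCertifiedByLMIOfSize ((n + 1) * (n + 1) * (m + 1))
      (nonnegForms G (2 * m) : Set (invariantForms G (2 * m))) := by
  have := isCertifiedByLMIOfSize_of_blocks (κ := Fin (n + 1) × Fin (n + 1)) m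
    (S := (nonnegForms G (2 * m) : Set (invariantForms G (2 * m))))
    (fun k => (blockRestriction n k.1 k.2).toLinearMap ∘ₗ (invariantForms G (2 * m)).subtype)
    (fun k f => natDegree_blockRestriction_le _ _ f.2.1) fun f => ?_
  · simpa using this
  · refine ⟨fun hf k t => ?_, fun hf => h f f.2 fun j hj l hl a b =>
      eval_blockVector_nonneg f.2.1 (fun t => ?_) a b⟩
    · exact (hf _).trans_eq (eval_blockRestriction _ _ _ _).symm
    · exact hf (⟨j, Nat.lt_succ_of_le hj⟩, ⟨l, Nat.lt_succ_of_le hl⟩) t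

/-- The bound `c * n ^ 3` is zero at `n = 0` and forces an empty LMI. Forms of positive degree
vanish at the only point, so the cone is the whole space. -/
theorem isCertifiedByLMIOfSize_zero {m : ℕ} (hm : m ≠ 0) (G : Subgroup (LinAut 0)) :
    IsCertifiedByLMIOfSize 0 (nonnegForms G (2 * m) : Set (invariantForms G (2 * m))) := by
  have := isCertifiedByLMIOfSize_of_blocks (κ := Fin 0) 0
    (S := (nonnegForms G (2 * m) : Set (invariantForms G (2 * m)))) (fun _ => 0) (by simp)
    fun f => ?_
  · simpa using this
  · refine ⟨fun _ k => k.elim0, fun _ x => ?_⟩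
    have := eval_smul_vector f.2.1 0 x
    rw [Subsingleton.elim (0 • x) x, zero_pow (by omega), zero_mul] at this
    exact this.ge

theorem exists_isCertifiedByLMIOfSize_nonnegForms {n m : ℕ} (hm : m ≠ 0) (hm' : m ≤ 5)
    {G : Subgroup (LinAut n)}
    (h : ∀ f ∈ invariantForms G (2 * m),
      (∀ j ≤ n, ∀ l ≤ n, ∀ a b, 0 ≤ eval (blockVector n j l a b) f) → ∀ x, 0 ≤ eval x f) :
    ∃ N ≤ 24 * n ^ 3, IsCertifiedByLMIOfSize N
      (nonnegForms G (2 * m) : Set (invariantForms G (2 * m))) := by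
  rcases Nat.eq_zero_or_pos n with rfl | hn
  · exact ⟨0, by simp, isCertifiedByLMIOfSize_zero hm G⟩
  · refine ⟨_, ?_, isCertifiedByLMIOfSize_nonnegForms h⟩
    -- For `n ≥ 1`, `n + 1 ≤ 2 * n`, and each block has order at most 6.
    calc (n + 1) * (n + 1) * (m + 1) ≤ (2 * n) * (2 * n) * 6 := by gcongr <;> omega
      _ = 24 * n ^ 2 := by ring
      _ ≤ 24 * n ^ 3 := by gcongr; omega

theorem IsCertifiedByLMIOfSize.isSpectrahedralShadow {V : Type*} [AddCommGroup V] [Module ℝ V]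
    {N : ℕ} {S : Set V} (h : IsCertifiedByLMIOfSize N S) : IsSpectrahedralShadow S := by
  obtain ⟨m, T, hT, hS⟩ := h
  refine ⟨m, T, ⟨N, hT⟩, Set.ext fun v => ?_⟩
  simp [hS]

end

theorem mainTheorem10 :
    (∀ n : ℕ,
      IsSpectrahedralShadow (nonnegForms (symGroup n) 4 : Set (invariantForms (symGroup n) 4)) ∧
      ∀ k ∈ ({6, 8, 10} : Set ℕ),
        IsSpectrahedralShadow (nonnegForms (hyperoctahedralGroup n) k :
          Set (invariantForms (hyperoctahedralGroup n) k))) ∧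
    ∃ c : ℕ, ∀ n : ℕ,
      (∃ N ≤ c * n ^ 3, IsCertifiedByLMIOfSize N
        (nonnegForms (symGroup n) 4 : Set (invariantForms (symGroup n) 4))) ∧
      ∀ k ∈ ({6, 8, 10} : Set ℕ),
        ∃ N ≤ c * n ^ 3, IsCertifiedByLMIOfSize N
          (nonnegForms (hyperoctahedralGroup n) k :
            Set (invariantForms (hyperoctahedralGroup n) k)) := by
  have hS : ∀ n, ∃ N ≤ 24 * n ^ 3, IsCertifiedByLMIOfSize N
      (nonnegForms (symGroup n) 4 : Set (invariantForms (symGroup n) 4)) := fun n =>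
    exists_isCertifiedByLMIOfSize_nonnegForms (m := 2) (by norm_num) (by norm_num)
      fun f hf => nonneg_of_blockVector_symGroup (by norm_num) hf
  have hB : ∀ n, ∀ k ∈ ({6, 8, 10} : Set ℕ), ∃ N ≤ 24 * n ^ 3, IsCertifiedByLMIOfSize N
      (nonnegForms (hyperoctahedralGroup n) k :
        Set (invariantForms (hyperoctahedralGroup n) k)) := fun n k hk => by
    obtain ⟨m, hm, hm', rfl⟩ : ∃ m, m ≠ 0 ∧ m ≤ 5 ∧ k = 2 * m := by
      rcases hk with rfl | rfl | rfl
      exacts [⟨3, by norm_num⟩, ⟨4, by norm_num⟩, ⟨5, by norm_num⟩]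
    exact exists_isCertifiedByLMIOfSize_nonnegForms hm hm'
      fun f hf => nonneg_of_blockVector_hyperoctahedralGroup hm' hf
  refine ⟨fun n => ⟨?_, fun k hk => ?_⟩, 24, fun n => ⟨hS n, hB n⟩⟩
  · obtain ⟨N, -, h⟩ := hS n
    exact h.isSpectrahedralShadow
  · obtain ⟨N, -, h⟩ := hB n k hk
    exact h.isSpectrahedralShadow
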